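/- **Conventions.** All Hilbert spaces are finite dimensional and $\log$ is the natural logarithm. For a Hermitian operator $A=\sum_i\lambda_i|i\rangle\langle i|$ put $\{A\ge 0\}=\sum_{\lambda_i\ge 0}|i\rangle\langle i|$. For a sequence of states $\rho=\{\rho_n\}$ and a sequence of positive operators $\omega=\{\omega_n\}$ let $\Pi_n(\gamma)=\rho_n-e^{n\gamma}\omega_n$ and $$\overline D(\rho\|\omega)=\inf\Big\{\gamma\in\mathbb R:\limsup_{n\to\infty}\mathrm{Tr}\big[\{\Pi_n(\gamma)\ge0\}\Pi_n(\gamma)\big]=0\Big\},\qquad \underline D(\rho\|\omega)=\sup\Big\{\gamma\in\mathbb R:\liminf_{n\to\infty}\mathrm{Tr}\big[\{\Pi_n(\gamma)\ge0\}\Pi_n(\gamma)\big]=1\Big\},$$ as elements of $[-\infty,\infty]$. The inf-spectral entropy rate is $\underline S(\rho)=-\overline D(\rho\|I)$, and for a sequence of bipartite states $\rho^{AB}$ the sup-spectral conditional entropy rate is $\overline S(A|B)=-\underline D(\rho^{AB}\|I^A\otimes\rho^B)$, where $\rho^B_n=\mathrm{Tr}_A\rho^{AB}_n$. An LOCC operation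 consists of finitely many rounds of local measurements (given by Kraus operators) with two-way classical communication; the local output dimensions may differ from the input dimensions. A concentration protocol for a sequence $\{\rho_n\}$ of bipartite states consists, for each $n$, of an LOCC operation $\mathcal T_n$ and a maximally entangled vector $|\Psi^+_{M_n}\rangle=M_n^{-1/2}\sum_{i=1}^{M_n}|i^A\rangle|i^B\rangle$ of rank $M_n\ge1$ in the output space (with $\{|i^A\rangle\}$ and $\{|i^B\rangle\}$ orthonormal). Its fidelity is $F_n=\langle\Psi^+_{M_n}|\mathcal T_n(\rho_n)|\Psi^+_{M_n}\rangle$, and it is reliable if $\liminf_{n\to\infty}F_n=1$. A real number $R$ is an achievable distillation rate if for every $\epsilon>0$ there is $N$ such that for every $n\ge N$ there are $\mathcal T_n$ and $|\Psi^+_{M_n}\rangle$ as above with $F_n\ge1-\epsilon$ and $\frac1n\log M_n\ge R$. **Theorem.** Let $\phi=\{|\phi_n\rangle\}$ be an arbitrary sequence of unit vectors $|\phi_n\rangle\in\mathcal H_A^{(n)}\otimes\mathcal H_B^{(n)}$, let $\phi_n^{AB}=|\phi_n\rangle\langle\phi_n|$, and let $\rho=\{\mathrm{Tr}_A\,\phi_n^{AB}\}$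 be the sequence of reduced states. Then: 1. (Monotonicity under LOCC.) For every sequence $\{\mathcal T_n\}$ of LOCC operations, with $\sigma^{AB}_n=\mathcal T_n(\phi^{AB}_n)$, one has $\overline S_\phi(A|B)\le\overline S_\sigma(A|B)$. 2. $\overline S_\phi(A|B)=-\underline S(\rho)$. 3. (Weak converse.) Every real $R>\underline S(\rho)$ is not an achievable distillation rate for $\{\phi_n^{AB}\}$. Moreover, no concentration protocol for $\{\phi_n^{AB}\}$ with $\frac1n\log M_n\ge R$ for all sufficiently large $n$ is reliable. -/

import Mathlib

open scoped Kronecker Matrix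

namespace EntConc

noncomputable section

/-- Linear operators on `ℂ^a ⊗ ℂ^b`, as matrices in the product basis. -/
abbrev BipOp (a b : ℕ) : Type := Matrix (Fin a × Fin b) (Fin a × Fin b) ℂ

/-- Vectors of the Hilbert space `ℂ^a ⊗ ℂ^b`. -/
abbrev BipVec (a b : ℕ) : Type := EuclideanSpace ℂ (Fin a × Fin b)

/-- The rank-one operator `|φ⟩⟨φ|`. -/
def ketBra {a b : ℕ} (φ : BipVec a b) : BipOp a b :=
  Matrix.of fun i j => φ i * star (φ j)

/-- The partial trace `Tr_A` over the first tensor factor. -/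
def trA {a b : ℕ} (ρ : BipOp a b) : Matrix (Fin b) (Fin b) ℂ :=
  Matrix.of fun i j => ∑ k, ρ (k, i) (k, j)

/-- The spectral projection `{A ≥ 0}` of a Hermitian matrix `A`: the sum of the eigenprojections
belonging to the nonnegative eigenvalues of `A` (see `spectralProj_eq`). -/
def spectralProj {ι : Type*} [Fintype ι] [DecidableEq ι] (A : Matrix ι ι ℂ) : Matrix ι ι ℂ :=
  cfc (fun x : ℝ => if 0 ≤ x then (1 : ℝ) else 0) A

theorem spectralProj_eq {ι : Type*} [Fintype ι] [DecidableEq ι] {A : Matrix ι ι ℂ}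
    (hA : A.IsHermitian) :
    spectralProj A = ∑ i with 0 ≤ hA.eigenvalues i,
      Matrix.of fun j k => hA.eigenvectorBasis i j * star (hA.eigenvectorBasis i k) := by
  rw [spectralProj, hA.cfc_eq, Matrix.IsHermitian.cfc, Unitary.conjStarAlgAut_apply]
  ext j k
  rw [Matrix.sum_apply, Finset.sum_filter, Matrix.mul_apply]
  refine Finset.sum_congr rfl fun i _ => ?_
  by_cases h : 0 ≤ hA.eigenvalues i <;>
    simp [h, Matrix.mul_diagonal, Matrix.star_apply, Matrix.IsHermitian.eigenvectorUnitary_apply]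

/-- `Tr[{Π ≥ 0} Π]` for the difference operator `Π = ρ - e^{nγ} ω`. -/
def spectralTrace {ι : Type*} [Fintype ι] [DecidableEq ι] (n : ℕ) (γ : ℝ)
    (ρ ω : Matrix ι ι ℂ) : ℝ :=
  (spectralProj (ρ - Real.exp (n * γ) • ω) * (ρ - Real.exp (n * γ) • ω)).trace.re

section Rates

variable {ι : ℕ → Type*} [∀ n, Fintype (ι n)] [∀ n, DecidableEq (ι n)]

/-- The spectral sup-divergence rate, as an extended real number. -/
def supDiv (ρ ω : ∀ n, Matrix (ι n) (ι n) ℂ) : EReal :=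
  sInf ((fun γ : ℝ => (γ : EReal)) ''
    {γ : ℝ | Filter.limsup (fun n => spectralTrace n γ (ρ n) (ω n)) Filter.atTop = 0})

/-- The spectral inf-divergence rate, as an extended real number. -/
def infDiv (ρ ω : ∀ n, Matrix (ι n) (ι n) ℂ) : EReal :=
  sSup ((fun γ : ℝ => (γ : EReal)) ''
    {γ : ℝ | Filter.liminf (fun n => spectralTrace n γ (ρ n) (ω n)) Filter.atTop = 1})

/-- The inf-spectral entropy rate. -/
def infEntropy (ρ : ∀ n, Matrix (ι n) (ι n) ℂ) : EReal :=
  -supDiv ρ (fun _ => 1)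

end Rates

/-- The sup-spectral conditional entropy rate of `A` given `B`. -/
def supCondEntropy {a b : ℕ → ℕ} (ρ : ∀ n, BipOp (a n) (b n)) : EReal :=
  -infDiv ρ (fun n => (1 : Matrix (Fin (a n)) (Fin (a n)) ℂ) ⊗ₖ trA (ρ n))

/-- LOCC operations from `ℂ^a ⊗ ℂ^b` to `ℂ^a' ⊗ ℂ^b'` with finitely many rounds of two-way
classical communication. In each round one party measures with Kraus operators `K j`, which may
change the dimension of that party's system, and announces the outcome `j`; the
parties then continue with an LOCC operation that may depend on `j`. Local channels and the
discarding of outcomes are included, since the continuation need not depend on `j`. -/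
inductive IsLOCC {a' b' : ℕ} : {a b : ℕ} → (BipOp a b → BipOp a' b') → Prop
  | done : IsLOCC (fun ρ : BipOp a' b' => ρ)
  | alice {a b k : ℕ} (c : Fin k → ℕ) (K : ∀ j, Matrix (Fin (c j)) (Fin a) ℂ)
      (hK : ∑ j, (K j)ᴴ * K j = 1) (T : ∀ j, BipOp (c j) b → BipOp a' b')
      (hT : ∀ j, IsLOCC (T j)) :
      IsLOCC (fun ρ : BipOp a b =>
        ∑ j, T j ((K j ⊗ₖ (1 : Matrix (Fin b) (Fin b) ℂ)) * ρ *
          (K j ⊗ₖ (1 : Matrix (Fin b) (Fin b) ℂ))ᴴ))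
  | bob {a b k : ℕ} (c : Fin k → ℕ) (K : ∀ j, Matrix (Fin (c j)) (Fin b) ℂ)
      (hK : ∑ j, (K j)ᴴ * K j = 1) (T : ∀ j, BipOp a (c j) → BipOp a' b')
      (hT : ∀ j, IsLOCC (T j)) :
      IsLOCC (fun ρ : BipOp a b =>
        ∑ j, T j (((1 : Matrix (Fin a) (Fin a) ℂ) ⊗ₖ K j) * ρ *
          ((1 : Matrix (Fin a) (Fin a) ℂ) ⊗ₖ K j)ᴴ))

/-- The vector `M^{-1/2} ∑ i, |e i⟩ ⊗ |f i⟩`; for orthonormal families `e` and `f` it is the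
maximally entangled state of rank `M`. -/
def maxEntangled {a b M : ℕ} (e : Fin M → EuclideanSpace ℂ (Fin a))
    (f : Fin M → EuclideanSpace ℂ (Fin b)) : BipVec a b :=
  WithLp.toLp 2 fun p => ((1 / Real.sqrt M : ℝ) : ℂ) * ∑ i, e i p.1 * f i p.2

/-- The fidelity `⟨ψ| σ |ψ⟩` of an operator `σ` with a target vector `ψ`. -/
def fidelity {a b : ℕ} (σ : BipOp a b) (ψ : BipVec a b) : ℝ :=
  (∑ p, ∑ q, star (ψ p) * σ p q * ψ q).re

/-- An entanglement concentration procedure on a single space `ℂ^a ⊗ ℂ^b`: an LOCC operation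
together with its target, a maximally entangled state of rank `M` of the output space. -/
structure Concentration (a b : ℕ) where
  outA : ℕ
  outB : ℕ
  M : ℕ
  M_pos : 0 < M
  e : Fin M → EuclideanSpace ℂ (Fin outA)
  f : Fin M → EuclideanSpace ℂ (Fin outB)
  e_orthonormal : Orthonormal ℂ e
  f_orthonormal : Orthonormal ℂ f
  T : BipOp a b → BipOp outA outB
  isLOCC : IsLOCC T

/-- The fidelity `⟨Ψ_M| T(ρ) |Ψ_M⟩` reached from the initial state `ρ`. -/
def Concentration.fid {a b : ℕ} (P : Concentration a b) (ρ : BipOp a b) : ℝ :=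
  fidelity (P.T ρ) (maxEntangled P.e P.f)

/-- `R` is an achievable distillation rate (under LOCC) for the sequence of states `ρ`. -/
def IsAchievableDistillationRate {a b : ℕ → ℕ} (ρ : ∀ n, BipOp (a n) (b n)) (R : ℝ) : Prop :=
  ∀ ε : ℝ, 0 < ε → ∃ N : ℕ, ∀ n, N ≤ n → ∃ P : Concentration (a n) (b n),
    1 - ε ≤ P.fid (ρ n) ∧ R ≤ 1 / (n : ℝ) * Real.log P.M

/-- A sequence of concentration procedures is reliable if its asymptotic fidelity is `1`. -/
def IsReliable {a b : ℕ → ℕ} (P : ∀ n, Concentration (a n) (b n))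
    (ρ : ∀ n, BipOp (a n) (b n)) : Prop :=
  Filter.liminf (fun n => (P n).fid (ρ n)) Filter.atTop = 1

end

end EntConc

namespace EntConc

set_option linter.unusedSectionVars false

noncomputable section

open scoped MatrixOrder ComplexOrder

/-! ### Trace of the positive part as a maximum over tests -/

section PositiveTrace

variable {ι κ : Type*} [Fintype ι] [DecidableEq ι] [Fintype κ] [DecidableEq κ]

/-! Everything rests on one quantity, the trace of the positive part of `ρ - c (1 ⊗ Tr_A ρ)`,
written `posTr (diffA c ρ)` and used at `c = exp (n γ)`. Since `posTr A` is the maximum of `Tr[P A]`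
over tests `0 ≤ P ≤ 1`, it is subadditive and cannot grow under a measurement.

Monotonicity: Bob's Kraus operators commute with forming `diffA`, Alice's with forming its mirror
image `diffB`. On pure vectors both have the same positive trace, because the Schmidt decomposition
makes the marginals interchangeable (`exists_schmidt_swap`). Conditional states stay pure during the
protocol and subadditivity handles the final mixture, so induction over rounds gives
`IsLOCC.posTr_diffA_le` for every fixed `c ≥ 0`, without asymptotics.

Entropy identity: let `q` be the weight of the reduced state `ρ` on its eigenvalues at most `t`. Up
to exponential slack in the thresholds, `posTr (diffA c φ) → 1` with `c` about `1/t` and `posTr (ρ -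
t) → 0` both mean `q → 1` (`le_posTr_diffA`, `posTr_diffA_le_lowProj`, and their one-system
analogues). The slack disappears in the supremum and infimum over `γ`.

Weak converse: the target state is itself a test, so fidelity minus `c / M` is at most `posTr (diffA
c φ)` by monotonicity (`Concentration.fid_sub_le`). At rate `R` this forces the limit 1 for each `γ
< R`, and the entropy identity turns this into a bound on `R`. -/

theorem continuousOn_real_spectrum (A : Matrix ι ι ℂ) (f : ℝ → ℝ) :
    ContinuousOn f (spectrum ℝ A) :=
  (Matrix.finite_real_spectrum (A := A)).continuousOn f

theorem re_trace_mono {A B : Matrix ι ι ℂ} (h : A ≤ B) : A.trace.re ≤ B.trace.re := by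
  have := (Matrix.le_iff.1 h).trace_nonneg
  rw [Matrix.trace_sub, Complex.nonneg_iff] at this
  simpa using this.1

theorem conj_mono {A B : Matrix ι ι ℂ} (h : A ≤ B) (K : Matrix κ ι ℂ) :
    K * A * Kᴴ ≤ K * B * Kᴴ := by
  rw [Matrix.le_iff] at h ⊢
  simpa [Matrix.mul_sub, Matrix.sub_mul] using h.mul_mul_conjTranspose_same K

theorem exists_eq_conjTranspose_mul_self {A : Matrix ι ι ℂ} (hA : 0 ≤ A) :
    ∃ B : Matrix ι ι ℂ, A = Bᴴ * B :=
  CStarAlgebra.nonneg_iff_eq_star_mul_self.1 hA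

theorem re_trace_mul_mono {P A B : Matrix ι ι ℂ} (hP : 0 ≤ P) (h : A ≤ B) :
    (P * A).trace.re ≤ (P * B).trace.re := by
  obtain ⟨R, rfl⟩ := exists_eq_conjTranspose_mul_self hP
  have := re_trace_mono (conj_mono h R)
  rwa [Matrix.mul_assoc R, Matrix.trace_mul_comm R, Matrix.mul_assoc R, Matrix.trace_mul_comm R,
    Matrix.mul_assoc, Matrix.mul_assoc, Matrix.trace_mul_comm, Matrix.trace_mul_comm B] at this

theorem re_trace_mul_mono_left {P Q A : Matrix ι ι ℂ} (hA : 0 ≤ A) (h : P ≤ Q) :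
    (P * A).trace.re ≤ (Q * A).trace.re := by
  rw [Matrix.trace_mul_comm P, Matrix.trace_mul_comm Q]
  exact re_trace_mul_mono hA h

theorem spectralProj_nonneg (A : Matrix ι ι ℂ) : 0 ≤ spectralProj A :=
  cfc_nonneg fun x _ => by split_ifs <;> norm_num

theorem spectralProj_le_one (A : Matrix ι ι ℂ) : spectralProj A ≤ 1 :=
  cfc_le_one _ _ fun x _ => by split_ifs <;> norm_num

theorem spectralProj_mul_self {A : Matrix ι ι ℂ} (hA : A.IsHermitian) :
    spectralProj A * A = cfc (fun x : ℝ => max x 0) A := by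
  have hA' : IsSelfAdjoint A := hA
  conv_lhs => rw [spectralProj]; arg 2; rw [← cfc_id ℝ A]
  rw [← cfc_mul _ _ A (continuousOn_real_spectrum _ _) (continuousOn_real_spectrum _ _)]
  refine cfc_congr fun x _ => ?_
  by_cases h : 0 ≤ x
  · simp [h]
  · simp [h, (not_le.1 h).le]

/-- `Tr[{A ≥ 0} A]`, the trace of the positive part of `A`. -/
def posTr (A : Matrix ι ι ℂ) : ℝ := (spectralProj A * A).trace.re

/-- Neyman–Pearson optimality: `A` lies below its positive part, and `P ≤ 1` can only lose trace
against a positive operator. -/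
theorem re_trace_mul_le_posTr {A P : Matrix ι ι ℂ} (hA : A.IsHermitian) (h0 : 0 ≤ P)
    (h1 : P ≤ 1) : (P * A).trace.re ≤ posTr A := by
  have hA' : IsSelfAdjoint A := hA
  have hpos : 0 ≤ spectralProj A * A := by
    rw [spectralProj_mul_self hA]
    exact cfc_nonneg fun x _ => le_max_right _ _
  have hle : A ≤ spectralProj A * A := by
    rw [spectralProj_mul_self hA]
    conv_lhs => rw [← cfc_id ℝ A]
    exact cfc_mono (fun x _ => le_max_left _ _) (continuousOn_real_spectrum _ _)
      (continuousOn_real_spectrum _ _)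
  calc (P * A).trace.re ≤ (P * (spectralProj A * A)).trace.re := re_trace_mul_mono h0 hle
    _ ≤ (1 * (spectralProj A * A)).trace.re := re_trace_mul_mono_left hpos h1
    _ = posTr A := by rw [one_mul, posTr]

theorem posTr_le_re_trace {A X : Matrix ι ι ℂ} (hX : 0 ≤ X) (h : A ≤ X) :
    posTr A ≤ X.trace.re :=
  calc posTr A ≤ (spectralProj A * X).trace.re := re_trace_mul_mono (spectralProj_nonneg A) h
    _ ≤ (1 * X).trace.re := re_trace_mul_mono_left hX (spectralProj_le_one A)
    _ = X.trace.re := by rw [one_mul]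

theorem posTr_nonneg {A : Matrix ι ι ℂ} (hA : A.IsHermitian) : 0 ≤ posTr A := by
  simpa using re_trace_mul_le_posTr hA le_rfl zero_le_one

/-- The optimal test for the sum is an admissible, possibly suboptimal, test for each summand. -/
theorem posTr_sum_le {k : Type*} (s : Finset k) {A : k → Matrix ι ι ℂ}
    (hA : ∀ j, (A j).IsHermitian) : posTr (∑ j ∈ s, A j) ≤ ∑ j ∈ s, posTr (A j) := by
  rw [posTr, Matrix.mul_sum, Matrix.trace_sum, Complex.re_sum]
  exact Finset.sum_le_sum fun j _ =>
    re_trace_mul_le_posTr (hA j) (spectralProj_nonneg _) (spectralProj_le_one _)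

/-- The trace of the positive part does not increase under a measurement. -/
theorem sum_posTr_conj_le {k : Type*} [Fintype k] {κ : k → Type*} [∀ j, Fintype (κ j)]
    [∀ j, DecidableEq (κ j)] {A : Matrix ι ι ℂ} (hA : A.IsHermitian)
    (K : ∀ j, Matrix (κ j) ι ℂ) (hK : ∑ j, (K j)ᴴ * K j = 1) :
    ∑ j, posTr (K j * A * (K j)ᴴ) ≤ posTr A := by
  -- The optimal tests for the separate outcomes, pulled back by the Kraus operators and summed,
  -- form a single admissible test for `A`.
  set P := fun j => spectralProj (K j * A * (K j)ᴴ)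
  have h0 : ∀ j, 0 ≤ (K j)ᴴ * P j * K j := fun j => by
    simpa using conj_mono (spectralProj_nonneg (K j * A * (K j)ᴴ)) (K j)ᴴ
  have h1 : ∀ j, (K j)ᴴ * P j * K j ≤ (K j)ᴴ * K j := fun j => by
    simpa using conj_mono (spectralProj_le_one (K j * A * (K j)ᴴ)) (K j)ᴴ
  have := re_trace_mul_le_posTr hA (Finset.sum_nonneg fun j _ => h0 j)
    ((Finset.sum_le_sum fun j _ => h1 j).trans hK.le)
  refine le_of_eq_of_le ?_ this
  rw [Matrix.sum_mul, Matrix.trace_sum, Complex.re_sum]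
  refine Finset.sum_congr rfl fun j _ => ?_
  rw [posTr, ← Matrix.mul_assoc, Matrix.trace_mul_comm]
  simp only [P, Matrix.mul_assoc]

theorem transpose_mono {A B : Matrix ι ι ℂ} (h : A ≤ B) : Aᵀ ≤ Bᵀ := by
  rw [Matrix.le_iff] at h ⊢
  simpa using h.transpose

theorem kronecker_mono_right {X : Matrix ι ι ℂ} (hX : 0 ≤ X) {A B : Matrix κ κ ℂ} (h : A ≤ B) :
    X ⊗ₖ A ≤ X ⊗ₖ B := by
  rw [Matrix.nonneg_iff_posSemidef] at hX
  rw [Matrix.le_iff] at h ⊢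
  have := hX.kronecker h
  convert this using 1
  ext
  simp [mul_sub]

theorem kronecker_mono_left {X : Matrix ι ι ℂ} (hX : 0 ≤ X) {A B : Matrix κ κ ℂ} (h : A ≤ B) :
    A ⊗ₖ X ≤ B ⊗ₖ X := by
  rw [Matrix.nonneg_iff_posSemidef] at hX
  rw [Matrix.le_iff] at h ⊢
  have := h.kronecker hX
  convert this using 1
  ext
  simp [sub_mul]

/-- Transposition preserves traces and order, so the optimal test for `A`, transposed and conjugated
by the contraction `Z`, becomes a test for `B`. The transpose accommodates the antiunitary nature of
the Schmidt swap. -/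
theorem posTr_le_of_transpose_le {A : Matrix ι ι ℂ} {B : Matrix κ κ ℂ} {Z : Matrix κ ι ℂ}
    (hB : B.IsHermitian) (hZ : Z * Zᴴ ≤ 1) (h : Aᵀ ≤ Zᴴ * B * Z) : posTr A ≤ posTr B := by
  have h0 : 0 ≤ (spectralProj A)ᵀ := by simpa using transpose_mono (spectralProj_nonneg A)
  have h1 : (spectralProj A)ᵀ ≤ 1 := by simpa using transpose_mono (spectralProj_le_one A)
  have h2 : 0 ≤ Z * (spectralProj A)ᵀ * Zᴴ := by simpa using conj_mono h0 Z
  have h3 : Z * (spectralProj A)ᵀ * Zᴴ ≤ 1 := by simpa using (conj_mono h1 Z).trans (by simpa)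
  calc posTr A = ((spectralProj A)ᵀ * Aᵀ).trace.re := by
        rw [posTr, ← Matrix.transpose_mul, Matrix.trace_transpose, Matrix.trace_mul_comm]
    _ ≤ ((spectralProj A)ᵀ * (Zᴴ * B * Z)).trace.re := re_trace_mul_mono h0 h
    _ = (Z * (spectralProj A)ᵀ * Zᴴ * B).trace.re := by
        rw [← Matrix.mul_assoc, Matrix.trace_mul_comm]
        simp only [Matrix.mul_assoc]
    _ ≤ posTr B := re_trace_mul_le_posTr hB h2 h3

end PositiveTrace

/-! ### Polar decomposition -/

section Polar

variable {ι κ : Type*} [Fintype ι] [DecidableEq ι] [Fintype κ] [DecidableEq κ]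

theorem mul_conjTranspose_le_one {U : Matrix ι κ ℂ} (h : U * Uᴴ * U = U) : U * Uᴴ ≤ 1 := by
  have h1 : U * Uᴴ * (U * Uᴴ) = U * Uᴴ := by rw [← Matrix.mul_assoc, h]
  rw [Matrix.le_iff]
  have := Matrix.posSemidef_conjTranspose_mul_self (1 - U * Uᴴ)
  simpa [Matrix.mul_sub, Matrix.sub_mul, h1] using this

/-- The partial isometry of the polar decomposition of a rectangular matrix. -/
theorem exists_polar (C : Matrix ι κ ℂ) : ∃ U : Matrix ι κ ℂ, U * Cᴴ * U = C ∧
    U * (Cᴴ * C) * Uᴴ = C * Cᴴ ∧ Uᴴ * (C * Cᴴ) * U = Cᴴ * C ∧ U * Uᴴ ≤ 1 ∧ Uᴴ * U ≤ 1 := by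
  set H := Cᴴ * C with hH
  have hpos : H.PosSemidef := Matrix.posSemidef_conjTranspose_mul_self C
  have hsa : IsSelfAdjoint H := hpos.isHermitian
  have hspec : ∀ x ∈ spectrum ℝ H, 0 ≤ x := fun x hx =>
    spectrum_nonneg_of_nonneg (Matrix.nonneg_iff_posSemidef.2 hpos) hx
  have hc := continuousOn_real_spectrum H
  have hmul : ∀ f g : ℝ → ℝ, cfc f H * cfc g H = cfc (fun x => f x * g x) H := fun f g =>
    (cfc_mul f g H (hc f) (hc g)).symm
  have hid : cfc (fun x : ℝ => x) H = H := cfc_id' ℝ H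
  -- Since `0⁻¹ = 0`, this is the pseudo-inverse of `|C| = √H`; the partial isometry will be `C *
  -- g`.
  set g := cfc (fun x : ℝ => (√x)⁻¹) H with hg
  set S := cfc (fun x : ℝ => √x) H with hS
  have hgsa : gᴴ = g := cfc_predicate (p := IsSelfAdjoint) _ H
  have hHg : H * g = S := by
    conv_lhs => rw [← hid]
    rw [hmul]
    exact cfc_congr fun x hx => by
      rcases (hspec x hx).eq_or_lt with rfl | h
      · simp
      · rw [← div_eq_mul_inv, Real.div_sqrt]
  have hgS : g * S = S * g := by
    rw [hmul, hmul]
    exact cfc_congr fun x _ => mul_comm _ _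
  have hggS : g * g * S = g := by
    rw [hmul, hmul]
    exact cfc_congr fun x _ => by
      by_cases h : √x = 0
      · simp [h]
      · field_simp
  have hSS : S * S = H := by
    conv_rhs => rw [← hid]
    rw [hmul]
    exact cfc_congr fun x hx => Real.mul_self_sqrt (hspec x hx)
  have hgH : g * H = S := by
    have := congrArg Matrix.conjTranspose hHg
    rwa [Matrix.conjTranspose_mul, hgsa, hpos.isHermitian.eq,
      show Sᴴ = S from cfc_predicate (p := IsSelfAdjoint) _ H] at this
  have hHgS : H * (g * S) = H := by rw [← Matrix.mul_assoc, hHg, hSS]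
  have hgSH : g * S * H = H := by rw [hgS, Matrix.mul_assoc, hgH, hSS]
  have hE : (g * S)ᴴ = g * S := by
    rw [Matrix.conjTranspose_mul, hgsa, show Sᴴ = S from cfc_predicate (p := IsSelfAdjoint) _ H, hgS]
  -- `g * S` is the support projection of `H`; the part of `C` outside it has zero Gram matrix,
  -- hence vanishes.
  have hC : C * (g * S) = C := by
    have h0 : (C - C * (g * S))ᴴ * (C - C * (g * S)) = 0 := by
      have e : (C - C * (g * S))ᴴ * (C - C * (g * S)) =
          H - H * (g * S) - (g * S * H - g * S * (H * (g * S))) := by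
        rw [Matrix.conjTranspose_sub, Matrix.conjTranspose_mul, hE, hH]
        simp only [Matrix.mul_sub, Matrix.sub_mul, Matrix.mul_assoc]
        abel
      rw [e, hHgS, hgSH, sub_self]
    exact (sub_eq_zero.1 (Matrix.conjTranspose_mul_self_eq_zero.1 h0)).symm
  have hUH : (C * g)ᴴ = g * Cᴴ := by rw [Matrix.conjTranspose_mul, hgsa]
  have hUUU : C * g * (C * g)ᴴ * (C * g) = C * g := by
    rw [hUH]
    calc C * g * (g * Cᴴ) * (C * g) = C * (g * g * (H * g)) := by simp only [hH, Matrix.mul_assoc]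
      _ = C * g := by rw [hHg, hggS]
  refine ⟨C * g, ?_, ?_, ?_, mul_conjTranspose_le_one hUUU, ?_⟩
  · calc C * g * Cᴴ * (C * g) = C * (g * (H * g)) := by simp only [hH, Matrix.mul_assoc]
      _ = C := by rw [hHg, hC]
  · rw [hUH]
    calc C * g * H * (g * Cᴴ) = C * (g * (H * g)) * Cᴴ := by simp only [Matrix.mul_assoc]
      _ = C * Cᴴ := by rw [hHg, hC]
  · rw [hUH]
    calc g * Cᴴ * (C * Cᴴ) * (C * g) = g * H * (H * g) := by simp only [hH, Matrix.mul_assoc]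
      _ = H := by rw [hHg, hgH, hSS]
  · have h : (C * g)ᴴ * (C * g)ᴴᴴ * (C * g)ᴴ = (C * g)ᴴ := by
      have := congrArg Matrix.conjTranspose hUUU
      simpa only [Matrix.conjTranspose_mul, Matrix.conjTranspose_conjTranspose,
        Matrix.mul_assoc] using this
    simpa only [Matrix.conjTranspose_conjTranspose] using mul_conjTranspose_le_one h

end Polar

/-! ### Marginals of pure states and the Schmidt swap -/

section Bipartite

/-- The partial trace `Tr_B` over the second tensor factor. -/
def trB {a b : ℕ} (ρ : BipOp a b) : Matrix (Fin a) (Fin a) ℂ :=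
  Matrix.of fun i j => ∑ k, ρ (i, k) (j, k)

/-- The coefficient matrix of a bipartite vector. -/
def coeffMatrix {a b : ℕ} (ψ : BipVec a b) : Matrix (Fin a) (Fin b) ℂ :=
  Matrix.of fun i j => ψ (i, j)

theorem trA_ketBra {a b : ℕ} (ψ : BipVec a b) :
    trA (ketBra ψ) = ((coeffMatrix ψ)ᴴ * coeffMatrix ψ)ᵀ := by
  ext i j
  simp [trA, ketBra, coeffMatrix, Matrix.mul_apply, mul_comm]

theorem trB_ketBra {a b : ℕ} (ψ : BipVec a b) :
    trB (ketBra ψ) = coeffMatrix ψ * (coeffMatrix ψ)ᴴ := by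
  ext i j
  simp [trB, ketBra, coeffMatrix, Matrix.mul_apply]

/-- `ρ - c (1 ⊗ Tr_A ρ)`. -/
def diffA {a b : ℕ} (c : ℝ) (ρ : BipOp a b) : BipOp a b :=
  ρ - c • ((1 : Matrix (Fin a) (Fin a) ℂ) ⊗ₖ trA ρ)

/-- `ρ - c (Tr_B ρ ⊗ 1)`. -/
def diffB {a b : ℕ} (c : ℝ) (ρ : BipOp a b) : BipOp a b :=
  ρ - c • (trB ρ ⊗ₖ (1 : Matrix (Fin b) (Fin b) ℂ))

theorem isHermitian_trA {a b : ℕ} {ρ : BipOp a b} (h : ρ.IsHermitian) : (trA ρ).IsHermitian := by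
  ext i j
  simp only [trA, Matrix.conjTranspose_apply, Matrix.of_apply, star_sum]
  exact Finset.sum_congr rfl fun k _ => h.apply _ _

theorem isHermitian_trB {a b : ℕ} {ρ : BipOp a b} (h : ρ.IsHermitian) : (trB ρ).IsHermitian := by
  ext i j
  simp only [trB, Matrix.conjTranspose_apply, Matrix.of_apply, star_sum]
  exact Finset.sum_congr rfl fun k _ => h.apply _ _

theorem isHermitian_real_smul {ι : Type*} {A : Matrix ι ι ℂ} (hA : A.IsHermitian) (c : ℝ) :
    (c • A).IsHermitian := by
  rw [Matrix.IsHermitian, Matrix.conjTranspose_smul, hA.eq, star_trivial]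

theorem isHermitian_diffA {a b : ℕ} (c : ℝ) {ρ : BipOp a b} (h : ρ.IsHermitian) :
    (diffA c ρ).IsHermitian := by
  refine h.sub (isHermitian_real_smul ?_ c)
  rw [Matrix.IsHermitian, Matrix.conjTranspose_kronecker, (isHermitian_trA h).eq,
    Matrix.conjTranspose_one]

theorem isHermitian_diffB {a b : ℕ} (c : ℝ) {ρ : BipOp a b} (h : ρ.IsHermitian) :
    (diffB c ρ).IsHermitian := by
  refine h.sub (isHermitian_real_smul ?_ c)
  rw [Matrix.IsHermitian, Matrix.conjTranspose_kronecker, (isHermitian_trB h).eq,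
    Matrix.conjTranspose_one]

theorem isHermitian_ketBra {a b : ℕ} (ψ : BipVec a b) : (ketBra ψ).IsHermitian := by
  ext i j
  simp [ketBra, mul_comm]

theorem real_smul_mono {ι : Type*} [Fintype ι] {A B : Matrix ι ι ℂ} (h : A ≤ B) {c : ℝ}
    (hc : 0 ≤ c) : c • A ≤ c • B := by
  rw [Matrix.le_iff] at h ⊢
  rw [← smul_sub]
  exact h.smul hc

theorem zero_le_one_matrix {ι : Type*} [Fintype ι] [DecidableEq ι] : (0 : Matrix ι ι ℂ) ≤ 1 :=
  zero_le_one

/-- The antiunitary swap of the two Schmidt bases exchanges the marginals of a pure state. -/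
theorem exists_schmidt_swap {a b : ℕ} (ψ : BipVec a b) : ∃ Z : BipOp a b, Z * Zᴴ ≤ 1 ∧
    Zᴴ * ketBra ψ * Z = (ketBra ψ)ᵀ ∧
    Zᴴ * ((1 : Matrix (Fin a) (Fin a) ℂ) ⊗ₖ trA (ketBra ψ)) * Z ≤
      (trB (ketBra ψ))ᵀ ⊗ₖ (1 : Matrix (Fin b) (Fin b) ℂ) ∧
    Zᴴ * (trB (ketBra ψ) ⊗ₖ (1 : Matrix (Fin b) (Fin b) ℂ)) * Z ≤
      (1 : Matrix (Fin a) (Fin a) ℂ) ⊗ₖ (trA (ketBra ψ))ᵀ := by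
  obtain ⟨U, h1, h2, h3, h4, h5⟩ := exists_polar (coeffMatrix ψ)
  have h4' : (U * Uᴴ)ᵀ ≤ 1 := by simpa using transpose_mono h4
  have h5' : (Uᴴ * U)ᵀ ≤ 1 := by simpa using transpose_mono h5
  rw [trA_ketBra, trB_ketBra]
  set C := coeffMatrix ψ with hC
  -- The polar isometry `U` carries one Schmidt basis to the other. Exchanging the column factors of
  -- `V` makes it an operator on the original space.
  set V := U ⊗ₖ Uᵀ with hV
  have hVH : Vᴴ = Uᴴ ⊗ₖ Uᵀᴴ := Matrix.conjTranspose_kronecker _ _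
  have hconj : ∀ (X : Matrix (Fin a) (Fin a) ℂ) (Y : Matrix (Fin b) (Fin b) ℂ),
      (V.submatrix id Prod.swap)ᴴ * (X ⊗ₖ Y) * V.submatrix id Prod.swap =
        (U * Yᵀ * Uᴴ)ᵀ ⊗ₖ (Uᴴ * X * U) := fun X Y => by
    have e : Vᴴ * (X ⊗ₖ Y) * V = (Uᴴ * X * U) ⊗ₖ (U * Yᵀ * Uᴴ)ᵀ := by
      rw [hVH, hV, ← Matrix.mul_kronecker_mul, ← Matrix.mul_kronecker_mul]
      simp only [Matrix.transpose_mul, Matrix.transpose_transpose, Matrix.mul_assoc]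
      rfl
    ext ⟨i, j⟩ ⟨k, l⟩
    have := congrFun (congrFun e (j, i)) (l, k)
    rw [Matrix.kroneckerMap_apply, mul_comm] at this
    exact this
  refine ⟨V.submatrix id Prod.swap, ?_, ?_, ?_, ?_⟩
  · have e : V.submatrix id Prod.swap * (V.submatrix id Prod.swap)ᴴ =
        (U * Uᴴ) ⊗ₖ (Uᴴ * U)ᵀ := by
      rw [Matrix.conjTranspose_submatrix]
      have := Matrix.submatrix_mul_equiv V Vᴴ id (Equiv.prodComm (Fin a) (Fin b)) id
      refine this.trans ?_
      rw [Matrix.submatrix_id_id, hVH, hV, ← Matrix.mul_kronecker_mul, Matrix.transpose_mul]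
      rfl
    rw [e]
    refine (kronecker_mono_left ?_ h4).trans
      ((kronecker_mono_right zero_le_one_matrix h5').trans ?_)
    · simpa using transpose_mono (Matrix.nonneg_iff_posSemidef.2
        (Matrix.posSemidef_conjTranspose_mul_self U))
    · rw [Matrix.one_kronecker_one]
  -- Entrywise this is the complex conjugate of `U * Cᴴ * U = C`: the adjoint of the swap sends `ψ`
  -- to its conjugate vector.
  · have hv : ∀ q, ∑ p, star (V.submatrix id Prod.swap p q) * ψ p = star (ψ q) := fun ⟨k, l⟩ => by
      have := congrArg star (congrFun (congrFun h1 k) l)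
      rw [Matrix.mul_assoc, Matrix.mul_apply] at this
      refine Eq.trans ?_ this
      rw [Fintype.sum_prod_type, Finset.sum_comm, star_sum]
      refine Finset.sum_congr rfl fun j _ => ?_
      simp only [Matrix.mul_apply, star_mul', star_sum, Finset.mul_sum, hV, hC, coeffMatrix,
        Matrix.submatrix_apply, Matrix.kroneckerMap_apply, Matrix.transpose_apply, id, Prod.swap,
        Matrix.conjTranspose_apply, Matrix.of_apply, star_star]
      exact Finset.sum_congr rfl fun _ _ => by ring
    ext p q
    simp only [Matrix.mul_apply, Matrix.conjTranspose_apply, ketBra, Matrix.of_apply,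
      Matrix.transpose_apply]
    have e : ∀ x, (∑ y, star (V.submatrix id Prod.swap y p) * (ψ y * star (ψ x))) *
        V.submatrix id Prod.swap x q =
        star (ψ p) * star (star (V.submatrix id Prod.swap x q) * ψ x) := fun x => by
      rw [← hv p, Finset.sum_mul, Finset.sum_mul]
      refine Finset.sum_congr rfl fun y _ => ?_
      rw [star_mul', star_star]
      ring
    rw [Finset.sum_congr rfl fun x _ => e x, ← Finset.mul_sum, ← star_sum, hv q, star_star,
      mul_comm]
  · rw [hconj, Matrix.transpose_transpose, h2, Matrix.mul_one]
    refine kronecker_mono_right ?_ h5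
    simpa using transpose_mono (Matrix.nonneg_iff_posSemidef.2
      (Matrix.posSemidef_self_mul_conjTranspose C))
  · rw [hconj, h3, Matrix.transpose_one, Matrix.mul_one, Matrix.transpose_transpose]
    exact kronecker_mono_left (Matrix.nonneg_iff_posSemidef.2
      (Matrix.posSemidef_conjTranspose_mul_self C)) h4'

theorem posTr_diffB_le {a b : ℕ} {c : ℝ} (hc : 0 ≤ c) (ψ : BipVec a b) :
    posTr (diffB c (ketBra ψ)) ≤ posTr (diffA c (ketBra ψ)) := by
  obtain ⟨Z, h1, h2, h3, -⟩ := exists_schmidt_swap ψ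
  refine posTr_le_of_transpose_le (isHermitian_diffA c (isHermitian_ketBra ψ)) h1 ?_
  have := sub_le_sub_left (real_smul_mono h3 hc) (ketBra ψ)ᵀ
  convert this using 1
  · rw [diffB, Matrix.transpose_sub, Matrix.transpose_smul, ← Matrix.kroneckerMap_transpose,
      Matrix.transpose_one]
  · rw [diffA, Matrix.mul_sub, Matrix.sub_mul, h2, Matrix.mul_smul, Matrix.smul_mul]

theorem posTr_diffA_le {a b : ℕ} {c : ℝ} (hc : 0 ≤ c) (ψ : BipVec a b) :
    posTr (diffA c (ketBra ψ)) ≤ posTr (diffB c (ketBra ψ)) := by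
  obtain ⟨Z, h1, h2, -, h3⟩ := exists_schmidt_swap ψ
  refine posTr_le_of_transpose_le (isHermitian_diffB c (isHermitian_ketBra ψ)) h1 ?_
  have := sub_le_sub_left (real_smul_mono h3 hc) (ketBra ψ)ᵀ
  convert this using 1
  · rw [diffA, Matrix.transpose_sub, Matrix.transpose_smul, ← Matrix.kroneckerMap_transpose,
      Matrix.transpose_one]
  · rw [diffB, Matrix.mul_sub, Matrix.sub_mul, h2, Matrix.mul_smul, Matrix.smul_mul]

end Bipartite
-- Monotonicity under LOCC
section Operations

variable {a b a' b' : ℕ}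

theorem posSemidef_ketBra (ψ : BipVec a b) : (ketBra ψ).PosSemidef :=
  Matrix.posSemidef_vecMulVec_self_star (R := ℂ) fun p => ψ p

theorem mul_ketBra_mul (M : Matrix (Fin a' × Fin b') (Fin a × Fin b) ℂ) (ψ : BipVec a b) :
    M * ketBra ψ * Mᴴ = ketBra (WithLp.toLp 2 (M *ᵥ ψ.ofLp) : BipVec a' b') := by
  ext p q
  simp only [Matrix.mul_apply, ketBra, Matrix.of_apply, Matrix.conjTranspose_apply,
    Matrix.mulVec, dotProduct, star_sum, star_mul', Finset.sum_mul, Finset.mul_sum]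
  exact Finset.sum_congr rfl fun _ _ => Finset.sum_congr rfl fun _ _ => by ring

theorem trA_sum {k : Type*} (s : Finset k) (ρ : k → BipOp a b) :
    trA (∑ j ∈ s, ρ j) = ∑ j ∈ s, trA (ρ j) := by
  ext i j
  simp only [trA, Matrix.of_apply, Matrix.sum_apply]
  exact Finset.sum_comm

theorem trA_bob (K : Matrix (Fin b') (Fin b) ℂ) (ρ : BipOp a b) :
    trA (((1 : Matrix (Fin a) (Fin a) ℂ) ⊗ₖ K) * ρ * ((1 : Matrix (Fin a) (Fin a) ℂ) ⊗ₖ K)ᴴ) =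
      K * trA ρ * Kᴴ := by
  ext i j
  simp only [trA, Matrix.of_apply, Matrix.mul_apply, Matrix.conjTranspose_kronecker,
    Matrix.kroneckerMap_apply, Fintype.sum_prod_type, Matrix.one_apply, Matrix.conjTranspose_one,
    ite_mul, mul_ite, zero_mul, mul_zero, one_mul, Finset.sum_ite_irrel, Finset.sum_const_zero,
    Finset.sum_ite_eq, Finset.sum_ite_eq', Finset.mem_univ, if_true, Finset.sum_mul,
    Finset.mul_sum]
  rw [Finset.sum_comm]
  refine Finset.sum_congr rfl fun _ _ => ?_
  rw [Finset.sum_comm]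

theorem trB_alice (K : Matrix (Fin a') (Fin a) ℂ) (ρ : BipOp a b) :
    trB ((K ⊗ₖ (1 : Matrix (Fin b) (Fin b) ℂ)) * ρ * (K ⊗ₖ (1 : Matrix (Fin b) (Fin b) ℂ))ᴴ) =
      K * trB ρ * Kᴴ := by
  ext i j
  simp only [trB, Matrix.of_apply, Matrix.mul_apply, Matrix.conjTranspose_kronecker,
    Matrix.kroneckerMap_apply, Fintype.sum_prod_type, Matrix.one_apply, Matrix.conjTranspose_one,
    ite_mul, mul_ite, zero_mul, mul_zero, mul_one,
    Finset.sum_ite_eq, Finset.sum_ite_eq', Finset.mem_univ, if_true, Finset.sum_mul,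
    Finset.mul_sum]
  rw [Finset.sum_comm]
  refine Finset.sum_congr rfl fun _ _ => ?_
  rw [Finset.sum_comm]

/-- `Tr_A` commutes with operations on `B`, so both terms are conjugated alike. Alice's operators
have no such rule here, as conjugation would replace the identity factor by `K * Kᴴ`. -/
theorem diffA_bob (c : ℝ) (K : Matrix (Fin b') (Fin b) ℂ) (ρ : BipOp a b) :
    diffA c (((1 : Matrix (Fin a) (Fin a) ℂ) ⊗ₖ K) * ρ *
        ((1 : Matrix (Fin a) (Fin a) ℂ) ⊗ₖ K)ᴴ) =
      ((1 : Matrix (Fin a) (Fin a) ℂ) ⊗ₖ K) * diffA c ρ *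
        ((1 : Matrix (Fin a) (Fin a) ℂ) ⊗ₖ K)ᴴ := by
  rw [diffA, diffA, trA_bob, Matrix.mul_sub, Matrix.sub_mul, Matrix.mul_smul, Matrix.smul_mul,
    Matrix.conjTranspose_kronecker, ← Matrix.mul_kronecker_mul, ← Matrix.mul_kronecker_mul,
    Matrix.conjTranspose_one, Matrix.mul_one, Matrix.mul_one]

theorem diffB_alice (c : ℝ) (K : Matrix (Fin a') (Fin a) ℂ) (ρ : BipOp a b) :
    diffB c ((K ⊗ₖ (1 : Matrix (Fin b) (Fin b) ℂ)) * ρ *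
        (K ⊗ₖ (1 : Matrix (Fin b) (Fin b) ℂ))ᴴ) =
      (K ⊗ₖ (1 : Matrix (Fin b) (Fin b) ℂ)) * diffB c ρ *
        (K ⊗ₖ (1 : Matrix (Fin b) (Fin b) ℂ))ᴴ := by
  rw [diffB, diffB, trB_alice, Matrix.mul_sub, Matrix.sub_mul, Matrix.mul_smul, Matrix.smul_mul,
    Matrix.conjTranspose_kronecker, ← Matrix.mul_kronecker_mul, ← Matrix.mul_kronecker_mul,
    Matrix.conjTranspose_one, Matrix.mul_one, Matrix.mul_one]

theorem diffA_sum (c : ℝ) {k : Type*} (s : Finset k) (ρ : k → BipOp a b) :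
    diffA c (∑ j ∈ s, ρ j) = ∑ j ∈ s, diffA c (ρ j) := by
  simp only [diffA, Finset.sum_sub_distrib, trA_sum, ← Finset.smul_sum]
  congr 2
  ext p q
  simp [Matrix.sum_apply, Finset.mul_sum]

theorem sum_kraus_alice {k : ℕ} {d : Fin k → ℕ} {K : ∀ j, Matrix (Fin (d j)) (Fin a) ℂ}
    (hK : ∑ j, (K j)ᴴ * K j = 1) :
    ∑ j, (K j ⊗ₖ (1 : Matrix (Fin b) (Fin b) ℂ))ᴴ * (K j ⊗ₖ (1 : Matrix (Fin b) (Fin b) ℂ)) =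
      1 := by
  rw [← Matrix.one_kronecker_one, ← hK]
  simp only [Matrix.conjTranspose_kronecker, ← Matrix.mul_kronecker_mul, Matrix.conjTranspose_one,
    Matrix.mul_one]
  ext p q
  simp [Matrix.sum_apply, Finset.sum_mul]

theorem sum_kraus_bob {k : ℕ} {d : Fin k → ℕ} {K : ∀ j, Matrix (Fin (d j)) (Fin b) ℂ}
    (hK : ∑ j, (K j)ᴴ * K j = 1) :
    ∑ j, ((1 : Matrix (Fin a) (Fin a) ℂ) ⊗ₖ K j)ᴴ * ((1 : Matrix (Fin a) (Fin a) ℂ) ⊗ₖ K j) =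
      1 := by
  rw [← Matrix.one_kronecker_one, ← hK]
  simp only [Matrix.conjTranspose_kronecker, ← Matrix.mul_kronecker_mul, Matrix.conjTranspose_one,
    Matrix.mul_one]
  ext p q
  simp [Matrix.sum_apply, Finset.mul_sum]

theorem trace_sum_conj {ι : Type*} [Fintype ι] [DecidableEq ι] {k : Type*} [Fintype k]
    {κ : k → Type*} [∀ j, Fintype (κ j)] {K : ∀ j, Matrix (κ j) ι ℂ}
    (hK : ∑ j, (K j)ᴴ * K j = 1) (A : Matrix ι ι ℂ) :
    ∑ j, (K j * A * (K j)ᴴ).trace = A.trace := by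
  have : ∀ j, (K j * A * (K j)ᴴ).trace = ((K j)ᴴ * K j * A).trace := fun j => by
    rw [Matrix.trace_mul_comm, Matrix.mul_assoc]
  rw [Finset.sum_congr rfl fun j _ => this j, ← Matrix.trace_sum, ← Matrix.sum_mul, hK, one_mul]

theorem IsLOCC.posSemidef {T : BipOp a b → BipOp a' b'} (hT : IsLOCC T) :
    ∀ {ρ : BipOp a b}, ρ.PosSemidef → (T ρ).PosSemidef := by
  induction hT with
  | done => exact fun h => h
  | alice d K hK T hT ih =>
    exact fun h => Matrix.posSemidef_sum _ fun j _ => ih j (h.mul_mul_conjTranspose_same _)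
  | bob d K hK T hT ih =>
    exact fun h => Matrix.posSemidef_sum _ fun j _ => ih j (h.mul_mul_conjTranspose_same _)

theorem IsLOCC.trace {T : BipOp a b → BipOp a' b'} (hT : IsLOCC T) :
    ∀ ρ : BipOp a b, (T ρ).trace = ρ.trace := by
  induction hT with
  | done => exact fun _ => rfl
  | alice d K hK T hT ih =>
    intro ρ
    rw [Matrix.trace_sum, Finset.sum_congr rfl fun j _ => ih j _]
    exact trace_sum_conj (sum_kraus_alice hK) ρ
  | bob d K hK T hT ih =>
    intro ρ
    rw [Matrix.trace_sum, Finset.sum_congr rfl fun j _ => ih j _]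
    exact trace_sum_conj (sum_kraus_bob hK) ρ

/-- For a pure initial state, `Tr[{Π ≥ 0} Π]` with `Π = ρ - c (1 ⊗ Tr_A ρ)` does not increase
under LOCC. -/
theorem IsLOCC.posTr_diffA_le {T : BipOp a b → BipOp a' b'} (hT : IsLOCC T) {c : ℝ} (hc : 0 ≤ c) :
    ∀ ψ : BipVec a b, posTr (diffA c (T (ketBra ψ))) ≤ posTr (diffA c (ketBra ψ)) := by
  induction hT with
  | done => exact fun _ => le_rfl
  | alice d K hK T hT ih =>
    intro ψ
    rw [diffA_sum]
    refine (posTr_sum_le _ fun j => isHermitian_diffA c ((hT j).posSemidef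
      ((posSemidef_ketBra ψ).mul_mul_conjTranspose_same _)).isHermitian).trans ?_
    -- Pass to `diffB` before Alice's measurement and back to `diffA` after it; both passages need
    -- purity. The vectors are unnormalized, so outcome probabilities are carried along.
    refine le_trans (Finset.sum_le_sum fun j _ => ?_) ((sum_posTr_conj_le
      (isHermitian_diffB c (isHermitian_ketBra ψ)) _ (sum_kraus_alice hK)).trans
      (posTr_diffB_le hc ψ))
    rw [← diffB_alice, mul_ketBra_mul]
    exact (ih j _).trans (EntConc.posTr_diffA_le hc _)
  | bob d K hK T hT ih =>
    intro ψ
    rw [diffA_sum]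
    refine (posTr_sum_le _ fun j => isHermitian_diffA c ((hT j).posSemidef
      ((posSemidef_ketBra ψ).mul_mul_conjTranspose_same _)).isHermitian).trans ?_
    refine le_trans (Finset.sum_le_sum fun j _ => ?_) (sum_posTr_conj_le
      (isHermitian_diffA c (isHermitian_ketBra ψ)) _ (sum_kraus_bob hK))
    rw [← diffA_bob, mul_ketBra_mul]
    exact ih j _

end Operations

/-! ### Spectral weight below a threshold -/

section LowProjection

variable {ι : Type*} [Fintype ι] [DecidableEq ι]

/-- The spectral projection `{A ≤ t}` of a Hermitian matrix `A`. -/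
def lowProj (t : ℝ) (A : Matrix ι ι ℂ) : Matrix ι ι ℂ :=
  cfc (fun x : ℝ => if x ≤ t then (1 : ℝ) else 0) A

theorem lowProj_nonneg (t : ℝ) (A : Matrix ι ι ℂ) : 0 ≤ lowProj t A :=
  cfc_nonneg fun x _ => by split_ifs <;> norm_num

theorem lowProj_le_one (t : ℝ) (A : Matrix ι ι ℂ) : lowProj t A ≤ 1 :=
  cfc_le_one _ _ fun x _ => by split_ifs <;> norm_num

theorem isHermitian_lowProj (t : ℝ) (A : Matrix ι ι ℂ) : (lowProj t A).IsHermitian :=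
  cfc_predicate (p := IsSelfAdjoint) _ A

theorem lowProj_mul_self (t : ℝ) (A : Matrix ι ι ℂ) :
    lowProj t A * lowProj t A = lowProj t A := by
  rw [lowProj, ← cfc_mul _ _ A (continuousOn_real_spectrum _ _) (continuousOn_real_spectrum _ _)]
  exact cfc_congr fun x _ => by split_ifs <;> norm_num

theorem cfc_le_cfc {A : Matrix ι ι ℂ} (hA : A.PosSemidef) {f g : ℝ → ℝ}
    (h : ∀ x, 0 ≤ x → f x ≤ g x) : cfc f A ≤ cfc g A :=
  cfc_mono (fun x hx => h x (spectrum_nonneg_of_nonneg (Matrix.nonneg_iff_posSemidef.2 hA) hx))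
    (continuousOn_real_spectrum _ _) (continuousOn_real_spectrum _ _)

theorem lowProj_mul_eq_cfc (t : ℝ) {A : Matrix ι ι ℂ} (hA : A.PosSemidef) :
    lowProj t A * A = cfc (fun x : ℝ => (if x ≤ t then (1 : ℝ) else 0) * x) A := by
  have hsa : IsSelfAdjoint A := hA.isHermitian
  conv_lhs => rw [lowProj]; arg 2; rw [← cfc_id' ℝ A]
  exact (cfc_mul _ _ A (continuousOn_real_spectrum _ _) (continuousOn_real_spectrum _ _)).symm

theorem sub_lowProj_mul_eq_cfc (t : ℝ) {A : Matrix ι ι ℂ} (hA : A.PosSemidef) :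
    A - lowProj t A * A = cfc (fun x : ℝ => x - (if x ≤ t then (1 : ℝ) else 0) * x) A := by
  have hsa : IsSelfAdjoint A := hA.isHermitian
  rw [lowProj_mul_eq_cfc t hA]
  conv_lhs => arg 1; rw [← cfc_id' ℝ A]
  exact (cfc_sub _ _ A (continuousOn_real_spectrum _ _) (continuousOn_real_spectrum _ _)).symm

theorem sub_smul_one_eq_cfc (t : ℝ) {A : Matrix ι ι ℂ} (hA : A.PosSemidef) :
    A - t • (1 : Matrix ι ι ℂ) = cfc (fun x : ℝ => x - t) A := by
  have hsa : IsSelfAdjoint A := hA.isHermitian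
  rw [cfc_sub _ _ A (continuousOn_real_spectrum _ _) (continuousOn_real_spectrum _ _),
    cfc_id' ℝ A, cfc_const t A, Algebra.algebraMap_eq_smul_one]

theorem one_sub_lowProj_eq_cfc (t : ℝ) {A : Matrix ι ι ℂ} (hA : A.PosSemidef) :
    1 - lowProj t A = cfc (fun x : ℝ => 1 - (if x ≤ t then (1 : ℝ) else 0)) A := by
  have hsa : IsSelfAdjoint A := hA.isHermitian
  rw [cfc_sub _ _ A (continuousOn_real_spectrum _ _) (continuousOn_real_spectrum _ _),
    cfc_const (1 : ℝ) A, map_one, lowProj]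

theorem smul_one_sub_lowProj_le {t : ℝ} {A : Matrix ι ι ℂ} (hA : A.PosSemidef) :
    t • (1 - lowProj t A) ≤ A := by
  have hsa : IsSelfAdjoint A := hA.isHermitian
  rw [one_sub_lowProj_eq_cfc t hA, ← cfc_smul t _ A (continuousOn_real_spectrum _ _)]
  conv_rhs => rw [← cfc_id' ℝ A]
  refine cfc_le_cfc hA fun x hx => ?_
  split_ifs with h
  · simpa using hx
  · simpa using (not_le.1 h).le

theorem re_trace_lowProj_conj_le {t : ℝ} (ht : 0 ≤ t) {A : Matrix ι ι ℂ} (hA : A.PosSemidef) :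
    (lowProj t A * A * lowProj t A * A).trace.re ≤ t * A.trace.re := by
  have hsa : IsSelfAdjoint A := hA.isHermitian
  have : lowProj t A * A * lowProj t A * A ≤ t • A := by
    rw [Matrix.mul_assoc, lowProj_mul_eq_cfc t hA,
      ← cfc_mul _ _ A (continuousOn_real_spectrum _ _) (continuousOn_real_spectrum _ _)]
    conv_rhs => arg 2; rw [← cfc_id' ℝ A]
    rw [← cfc_smul t _ A (continuousOn_real_spectrum _ _)]
    refine cfc_le_cfc hA fun x hx => ?_
    split_ifs with h
    · simpa using mul_le_mul_of_nonneg_right h hx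
    · simpa using mul_nonneg ht hx
  simpa [Matrix.trace_smul] using re_trace_mono this

theorem posTr_sub_smul_one_le {t : ℝ} (ht : 0 ≤ t) {A : Matrix ι ι ℂ} (hA : A.PosSemidef) :
    posTr (A - t • (1 : Matrix ι ι ℂ)) ≤ A.trace.re - (lowProj t A * A).trace.re := by
  rw [← Complex.sub_re, ← Matrix.trace_sub]
  refine posTr_le_re_trace ?_ ?_
  · rw [sub_lowProj_mul_eq_cfc t hA]
    refine cfc_nonneg fun x hx => ?_
    have := spectrum_nonneg_of_nonneg (Matrix.nonneg_iff_posSemidef.2 hA) hx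
    split_ifs
    · simp
    · simpa
  · rw [sub_lowProj_mul_eq_cfc t hA, sub_smul_one_eq_cfc t hA]
    refine cfc_le_cfc hA fun x hx => ?_
    split_ifs with h
    · simpa using h
    · simpa using ht

/-- Test with the projection onto eigenvalues `x > t`, where `x - s ≥ (1 - s / t) x`. -/
theorem le_posTr_sub_smul_one {s t : ℝ} (hs : 0 ≤ s) (ht : 0 < t)
    {A : Matrix ι ι ℂ} (hA : A.PosSemidef) :
    (1 - s / t) * (A.trace.re - (lowProj t A * A).trace.re) ≤
      posTr (A - s • (1 : Matrix ι ι ℂ)) := by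
  have h1 : (1 - lowProj t A : Matrix ι ι ℂ) ≤ 1 := sub_le_self _ (lowProj_nonneg t A)
  have h0 : (0 : Matrix ι ι ℂ) ≤ 1 - lowProj t A := sub_nonneg.2 (lowProj_le_one t A)
  have hH : (A - s • (1 : Matrix ι ι ℂ)).IsHermitian :=
    hA.isHermitian.sub (isHermitian_real_smul Matrix.isHermitian_one s)
  refine le_trans ?_ (re_trace_mul_le_posTr hH h0 h1)
  have : (1 - s / t) • (A - lowProj t A * A) ≤ (1 - lowProj t A) * (A - s • (1 : Matrix ι ι ℂ)) := by
    rw [sub_lowProj_mul_eq_cfc t hA, one_sub_lowProj_eq_cfc t hA, sub_smul_one_eq_cfc s hA,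
      ← cfc_smul _ _ A (continuousOn_real_spectrum _ _),
      ← cfc_mul _ _ A (continuousOn_real_spectrum _ _) (continuousOn_real_spectrum _ _)]
    refine cfc_le_cfc hA fun x hx => ?_
    split_ifs with h
    · simp
    · have : s ≤ s / t * x := by
        rw [div_mul_eq_mul_div, le_div_iff₀ ht]
        exact mul_le_mul_of_nonneg_left (not_le.1 h).le hs
      simp only [zero_mul, sub_zero, one_mul, smul_eq_mul]
      linarith
  simpa [Matrix.trace_smul, Matrix.trace_sub] using re_trace_mono this

end LowProjection

/-! ### One-shot bounds for pure states and for the fidelity -/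

section PureStates

variable {a b : ℕ}

theorem trace_one_kronecker_mul (X : Matrix (Fin b) (Fin b) ℂ) (ρ : BipOp a b) :
    (((1 : Matrix (Fin a) (Fin a) ℂ) ⊗ₖ X) * ρ).trace = (X * trA ρ).trace := by
  simp only [Matrix.trace, Matrix.diag, Matrix.mul_apply, trA, Matrix.of_apply,
    Matrix.kroneckerMap_apply, Fintype.sum_prod_type, Matrix.one_apply,
    ite_mul, zero_mul, one_mul, Finset.sum_ite_irrel, Finset.sum_const_zero,
    Finset.sum_ite_eq, Finset.mem_univ, if_true, Finset.mul_sum]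
  rw [Finset.sum_comm]
  refine Finset.sum_congr rfl fun _ _ => ?_
  rw [Finset.sum_comm]

theorem trace_trA (ρ : BipOp a b) : (trA ρ).trace = ρ.trace := by
  simpa using (trace_one_kronecker_mul 1 ρ).symm

theorem posSemidef_trA {ρ : BipOp a b} (h : ρ.PosSemidef) : (trA ρ).PosSemidef := by
  have e : trA ρ = ∑ k, ρ.submatrix (fun i => (k, i)) (fun i => (k, i)) := by
    ext
    simp [trA, Matrix.sum_apply]
  rw [e]
  exact Matrix.posSemidef_sum _ fun k _ => h.submatrix _

theorem trace_ketBra {φ : BipVec a b} (hφ : ‖φ‖ = 1) : (ketBra φ).trace = 1 := by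
  have h : (∑ p, ‖φ p‖ ^ 2 : ℝ) = 1 := by rw [← EuclideanSpace.norm_sq_eq, hφ, one_pow]
  have : ∀ p, φ p * star (φ p) = ((‖φ p‖ ^ 2 : ℝ) : ℂ) := fun p => by
    rw [Complex.star_def, Complex.mul_conj, Complex.normSq_eq_norm_sq]
  simp only [Matrix.trace, Matrix.diag, ketBra, Matrix.of_apply, this]
  rw [← Complex.ofReal_sum, h, Complex.ofReal_one]

theorem ketBra_mul_mul_ketBra (φ : BipVec a b) (X : BipOp a b) :
    ketBra φ * X * ketBra φ = (X * ketBra φ).trace • ketBra φ := by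
  ext p q
  simp only [Matrix.mul_apply, ketBra, Matrix.of_apply, Matrix.smul_apply, Matrix.trace,
    Matrix.diag, smul_eq_mul, Finset.sum_mul]
  rw [Finset.sum_comm]
  exact Finset.sum_congr rfl fun _ _ => Finset.sum_congr rfl fun _ _ => by ring

theorem ketBra_le_one {φ : BipVec a b} (hφ : (ketBra φ).trace = 1) : ketBra φ ≤ 1 := by
  have h := ketBra_mul_mul_ketBra φ 1
  rw [Matrix.mul_one, Matrix.one_mul, hφ, one_smul] at h
  have := mul_conjTranspose_le_one (U := ketBra φ) (by rw [(isHermitian_ketBra φ).eq, h, h])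
  rwa [(isHermitian_ketBra φ).eq, h] at this

/-- With `N = 1 ⊗ {ρ ≤ t}`, the test `N |φ⟩⟨φ| N` has overlap `⟨φ|N|φ⟩²` with the state, while its
overlap with `1 ⊗ ρ` is `Tr[QρQρ] ≤ t`, where `Q = {ρ ≤ t}`. -/
theorem le_posTr_diffA {c t : ℝ} (hc : 0 ≤ c) (ht : 0 ≤ t) {φ : BipVec a b} (hφ : ‖φ‖ = 1) :
    (lowProj t (trA (ketBra φ)) * trA (ketBra φ)).trace.re ^ 2 - c * t ≤
      posTr (diffA c (ketBra φ)) := by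
  have hk := trace_ketBra hφ
  set ρ := trA (ketBra φ) with hρ
  have hρ0 : ρ.PosSemidef := posSemidef_trA (posSemidef_ketBra φ)
  have hρ1 : ρ.trace = 1 := by rw [hρ, trace_trA, hk]
  set Q := lowProj t ρ
  set N : BipOp a b := (1 : Matrix (Fin a) (Fin a) ℂ) ⊗ₖ Q with hN
  have hNH : Nᴴ = N := by
    rw [hN, Matrix.conjTranspose_kronecker, Matrix.conjTranspose_one, (isHermitian_lowProj t ρ).eq]
  have hNN : N * N = N := by
    rw [hN, ← Matrix.mul_kronecker_mul, Matrix.one_mul, lowProj_mul_self]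
  have hN1 : N ≤ 1 := by
    rw [← Matrix.one_kronecker_one]
    exact kronecker_mono_right zero_le_one_matrix (lowProj_le_one t ρ)
  have hP0 : 0 ≤ N * ketBra φ * N := by
    simpa [hNH] using conj_mono (Matrix.nonneg_iff_posSemidef.2 (posSemidef_ketBra φ)) N
  have hP1 : N * ketBra φ * N ≤ 1 := by
    have := conj_mono (ketBra_le_one hk) N
    rw [hNH, Matrix.mul_one, hNN] at this
    exact this.trans hN1
  refine le_trans ?_ (re_trace_mul_le_posTr
    (isHermitian_diffA c (isHermitian_ketBra φ)) hP0 hP1)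
  have h1 : (N * ketBra φ * N * ketBra φ).trace = (Q * ρ).trace * (Q * ρ).trace := by
    rw [Matrix.mul_assoc, Matrix.mul_assoc N, ← Matrix.mul_assoc (ketBra φ),
      ketBra_mul_mul_ketBra, Matrix.mul_smul, Matrix.trace_smul, smul_eq_mul,
      trace_one_kronecker_mul]
  have h2 : (N * ketBra φ * N * ((1 : Matrix (Fin a) (Fin a) ℂ) ⊗ₖ ρ)).trace =
      (Q * ρ * Q * ρ).trace := by
    rw [Matrix.mul_assoc, Matrix.trace_mul_comm, ← Matrix.mul_assoc, hN,
      ← Matrix.mul_kronecker_mul, ← Matrix.mul_kronecker_mul, Matrix.one_mul, Matrix.one_mul,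
      trace_one_kronecker_mul]
  have him : (Q * ρ).trace.im = 0 := by
    have := congrArg Complex.im (Matrix.trace_conjTranspose (Q * ρ))
    rw [Matrix.conjTranspose_mul, hρ0.isHermitian.eq, (isHermitian_lowProj t ρ).eq,
      Matrix.trace_mul_comm, Complex.star_def, Complex.conj_im] at this
    linarith
  have h3 := re_trace_lowProj_conj_le ht hρ0
  rw [hρ1, Complex.one_re, mul_one] at h3
  rw [diffA, Matrix.mul_sub, Matrix.trace_sub, Matrix.mul_smul, Matrix.trace_smul, h1, h2,
    Complex.sub_re, Complex.mul_re, him, Complex.real_smul, Complex.re_ofReal_mul]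
  have := mul_le_mul_of_nonneg_left h3 hc
  nlinarith

/-- Split the state by `N = 1 ⊗ {ρ ≤ t}`. The block on `1 - N` is absorbed by `c (1 ⊗ ρ)`, since
there `c ρ ≥ c t ≥ 1 + s`; only the block on `N` contributes. -/
theorem posTr_diffA_le_lowProj {c s t : ℝ} (hc : 0 ≤ c) (hs : 0 < s) (hst : 1 + s ≤ c * t)
    {φ : BipVec a b} (hφ : ‖φ‖ = 1) :
    posTr (diffA c (ketBra φ)) ≤
      (1 + 1 / s) * (lowProj t (trA (ketBra φ)) * trA (ketBra φ)).trace.re := by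
  have hk := trace_ketBra hφ
  set k := ketBra φ with hk_def
  set ρ := trA k with hρ
  have hρ0 : ρ.PosSemidef := posSemidef_trA (posSemidef_ketBra φ)
  set Q := lowProj t ρ
  set N : BipOp a b := (1 : Matrix (Fin a) (Fin a) ℂ) ⊗ₖ Q with hN
  have hNH : Nᴴ = N := by
    rw [hN, Matrix.conjTranspose_kronecker, Matrix.conjTranspose_one, (isHermitian_lowProj t ρ).eq]
  have hNN : N * N = N := by
    rw [hN, ← Matrix.mul_kronecker_mul, Matrix.one_mul, lowProj_mul_self]
  have hk0 : 0 ≤ k := Matrix.nonneg_iff_posSemidef.2 (posSemidef_ketBra φ)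
  have hM : (1 - N) * k * (1 - N) ≤ 1 - N := by
    have := conj_mono (ketBra_le_one hk) (1 - N)
    rw [Matrix.conjTranspose_sub, hNH, Matrix.conjTranspose_one, Matrix.mul_one] at this
    refine this.trans_eq ?_
    simp [Matrix.mul_sub, Matrix.sub_mul, hNN]
  -- Divided by `s`, this is the weighted AM–GM inequality bounding the cross terms of `k` between
  -- `N` and `1 - N`.
  have hcross : 0 ≤ (s • (1 - N) - N) * k * (s • (1 - N) - N) := by
    have := conj_mono hk0 (s • (1 - N) - N)
    simpa [Matrix.conjTranspose_sub, Matrix.conjTranspose_smul, hNH] using this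
  have hsplit : k ≤ (1 + 1 / s) • (N * k * N) + (1 + s) • ((1 - N) * k * (1 - N)) := by
    have h := real_smul_mono hcross (one_div_nonneg.2 hs.le)
    rw [smul_zero] at h
    rw [← sub_nonneg]
    refine h.trans_eq ?_
    have hs' : s ≠ 0 := hs.ne'
    simp only [Matrix.mul_sub, Matrix.sub_mul, Matrix.mul_smul, Matrix.smul_mul, Matrix.one_mul,
      Matrix.mul_one, smul_sub, smul_smul]
    match_scalars <;> field_simp <;> ring
  have hρN : (1 + s) • (1 - N) ≤ c • ((1 : Matrix (Fin a) (Fin a) ℂ) ⊗ₖ ρ) := by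
    have h1 : (1 - N : BipOp a b) = (1 : Matrix (Fin a) (Fin a) ℂ) ⊗ₖ (1 - Q) := by
      rw [hN, ← Matrix.one_kronecker_one]
      ext p q
      simp only [Matrix.sub_apply, Matrix.kroneckerMap_apply, mul_sub]
    have h2 : (1 + s) • (1 - Q) ≤ c • ρ := by
      have h3 := real_smul_mono (smul_one_sub_lowProj_le (t := t) hρ0) hc
      rw [smul_smul] at h3
      refine le_trans ?_ h3
      rw [← sub_nonneg, ← sub_smul]
      simpa using real_smul_mono (sub_nonneg.2 (lowProj_le_one t ρ)) (sub_nonneg.2 hst)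
    rw [h1, ← Matrix.kronecker_smul, ← Matrix.kronecker_smul]
    exact kronecker_mono_right zero_le_one_matrix h2
  have hX0 : 0 ≤ (1 + 1 / s) • (N * k * N) := by
    have h1 : 0 ≤ N * k * N := by simpa [hNH] using conj_mono hk0 N
    simpa using real_smul_mono h1 (by positivity : (0 : ℝ) ≤ 1 + 1 / s)
  have hX : diffA c k ≤ (1 + 1 / s) • (N * k * N) := by
    rw [diffA, sub_le_iff_le_add]
    exact hsplit.trans (add_le_add_right
      ((real_smul_mono hM (by positivity)).trans hρN) _)
  refine (posTr_le_re_trace hX0 hX).trans_eq ?_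
  rw [Matrix.trace_smul, Complex.real_smul, Complex.re_ofReal_mul, Matrix.mul_assoc,
    Matrix.trace_mul_comm, Matrix.mul_assoc, hNN, Matrix.trace_mul_comm, trace_one_kronecker_mul]

theorem posTr_diffA_le_trace {c : ℝ} (hc : 0 ≤ c) {ρ : BipOp a b} (hρ : ρ.PosSemidef) :
    posTr (diffA c ρ) ≤ ρ.trace.re := by
  refine posTr_le_re_trace (Matrix.nonneg_iff_posSemidef.2 hρ) (sub_le_self _ ?_)
  have := kronecker_mono_right (zero_le_one_matrix (ι := Fin a)) (Matrix.nonneg_iff_posSemidef.2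
    (posSemidef_trA hρ))
  simpa using real_smul_mono this hc

/-- Use the target projection as the test: its marginal on `B` is at most `1 / M`, hence so is its
overlap with `1 ⊗ Tr_A σ`. -/
theorem fidelity_sub_le_posTr {M : ℕ} (hM : 0 < M) {e : Fin M → EuclideanSpace ℂ (Fin a)}
    {f : Fin M → EuclideanSpace ℂ (Fin b)} (he : Orthonormal ℂ e) (hf : Orthonormal ℂ f) {c : ℝ}
    (hc : 0 ≤ c) {σ : BipOp a b} (hσ : σ.PosSemidef) (hσ1 : σ.trace = 1) :
    fidelity σ (maxEntangled e f) - c / M ≤ posTr (diffA c σ) := by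
  set Ψ := maxEntangled e f with hΨ
  set E : Matrix (Fin a) (Fin M) ℂ := Matrix.of fun p i => e i p with hE
  set F : Matrix (Fin b) (Fin M) ℂ := Matrix.of fun p i => f i p with hF
  have hEE : Eᴴ * E = 1 := by
    ext i j
    have := (orthonormal_iff_ite.1 he) i j
    rw [Matrix.one_apply, ← this]
    simp [E, Matrix.mul_apply, PiLp.inner_apply, mul_comm]
  have hFF : Fᴴ * F = 1 := by
    ext i j
    have := (orthonormal_iff_ite.1 hf) i j
    rw [Matrix.one_apply, ← this]
    simp [F, Matrix.mul_apply, PiLp.inner_apply, mul_comm]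
  have hM' : (0 : ℝ) < M := Nat.cast_pos.2 hM
  have hC : coeffMatrix Ψ = (1 / √M : ℝ) • (E * Fᵀ) := by
    ext i j
    simp [coeffMatrix, hΨ, maxEntangled, Matrix.mul_apply, E, F]
  have hB : trA (ketBra Ψ) = (1 / M : ℝ) • (F * Fᴴ) := by
    have h1 : (E * Fᵀ)ᴴ * (E * Fᵀ) = (F * Fᴴ)ᵀ := by
      rw [Matrix.conjTranspose_mul, Matrix.mul_assoc, ← Matrix.mul_assoc Eᴴ, hEE, Matrix.one_mul,
        Matrix.transpose_mul]
      rfl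
    rw [trA_ketBra, hC, Matrix.conjTranspose_smul, star_trivial, Matrix.smul_mul, Matrix.mul_smul,
      smul_smul, h1, Matrix.transpose_smul, Matrix.transpose_transpose, div_mul_div_comm,
      Real.mul_self_sqrt hM'.le, one_mul]
  have htr : (ketBra Ψ).trace = 1 := by
    rw [← trace_trA, hB, Matrix.trace_smul, Matrix.trace_mul_comm, hFF, Matrix.trace_one,
      Fintype.card_fin, Complex.real_smul]
    push_cast
    exact one_div_mul_cancel (Nat.cast_ne_zero.2 hM.ne')
  refine le_trans ?_ (re_trace_mul_le_posTr (isHermitian_diffA c hσ.isHermitian)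
    (Matrix.nonneg_iff_posSemidef.2 (posSemidef_ketBra Ψ)) (ketBra_le_one htr))
  have h1 : fidelity σ Ψ = (ketBra Ψ * σ).trace.re := by
    rw [fidelity, Matrix.trace_mul_comm]
    congr 1
    simp only [Matrix.trace, Matrix.diag, Matrix.mul_apply, ketBra, Matrix.of_apply]
    exact Finset.sum_congr rfl fun _ _ => Finset.sum_congr rfl fun _ _ => by ring
  have h2 : (ketBra Ψ * ((1 : Matrix (Fin a) (Fin a) ℂ) ⊗ₖ trA σ)).trace.re ≤ 1 / M := by
    have hle : F * Fᴴ ≤ 1 := mul_conjTranspose_le_one (by rw [Matrix.mul_assoc, hFF, Matrix.mul_one])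
    have h3 := re_trace_mul_mono (Matrix.nonneg_iff_posSemidef.2 (posSemidef_trA hσ))
      (real_smul_mono hle (one_div_nonneg.2 hM'.le))
    rw [Matrix.trace_mul_comm, trace_one_kronecker_mul, hB]
    refine h3.trans_eq ?_
    rw [Matrix.mul_smul, Matrix.mul_one, Matrix.trace_smul, trace_trA, hσ1, Complex.real_smul,
      mul_one, Complex.ofReal_re]
  rw [diffA, Matrix.mul_sub, Matrix.trace_sub, Matrix.mul_smul, Matrix.trace_smul, Complex.sub_re,
    Complex.real_smul, Complex.re_ofReal_mul, ← h1, div_eq_mul_one_div]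
  exact sub_le_sub_left (mul_le_mul_of_nonneg_left h2 hc) _

end PureStates

/-! ### Passage to spectral rates -/

section Asymptotics

open Filter Topology

theorem liminf_eq_one_iff_tendsto {u : ℕ → ℝ} (h0 : ∀ n, 0 ≤ u n) (h1 : ∀ n, u n ≤ 1) :
    liminf u atTop = 1 ↔ Tendsto u atTop (𝓝 1) := by
  have ha : IsBoundedUnder (· ≤ ·) atTop u := isBoundedUnder_of ⟨1, h1⟩
  have hb : IsBoundedUnder (· ≥ ·) atTop u := isBoundedUnder_of ⟨0, h0⟩
  refine ⟨fun h => tendsto_of_le_liminf_of_limsup_le h.ge ?_ ha hb, fun h => h.liminf_eq⟩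
  exact limsup_le_of_le hb.isCoboundedUnder_flip (Eventually.of_forall h1)

theorem limsup_eq_zero_iff_tendsto {u : ℕ → ℝ} (h0 : ∀ n, 0 ≤ u n) (h1 : ∀ n, u n ≤ 1) :
    limsup u atTop = 0 ↔ Tendsto u atTop (𝓝 0) := by
  have ha : IsBoundedUnder (· ≤ ·) atTop u := isBoundedUnder_of ⟨1, h1⟩
  have hb : IsBoundedUnder (· ≥ ·) atTop u := isBoundedUnder_of ⟨0, h0⟩
  refine ⟨fun h => tendsto_of_le_liminf_of_limsup_le ?_ h.le ha hb, fun h => h.limsup_eq⟩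
  exact le_liminf_of_le ha.isCoboundedUnder_flip (Eventually.of_forall h0)

theorem tendsto_exp_nat_mul_atTop {δ : ℝ} (hδ : 0 < δ) :
    Tendsto (fun n : ℕ => Real.exp (n * δ)) atTop atTop :=
  Real.tendsto_exp_atTop.comp (tendsto_natCast_atTop_atTop.atTop_mul_const hδ)

theorem tendsto_exp_nat_mul_zero {δ : ℝ} (hδ : δ < 0) :
    Tendsto (fun n : ℕ => Real.exp (n * δ)) atTop (𝓝 0) :=
  Real.tendsto_exp_atBot.comp (tendsto_natCast_atTop_atTop.atTop_mul_const_of_neg hδ)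

/-- The hypotheses make `-A` and `B` agree up to boundary points. Working in `EReal` covers empty
and unbounded sets. -/
theorem neg_sSup_eq_sInf {A B : Set ℝ} (hBA : ∀ x ∈ B, ∀ y, y < -x → y ∈ A)
    (hAB : ∀ x ∈ A, ∀ y, -x < y → y ∈ B) :
    -sSup ((fun γ : ℝ => (γ : EReal)) '' A) = sInf ((fun γ : ℝ => (γ : EReal)) '' B) := by
  apply le_antisymm
  · refine le_sInf ?_
    rintro _ ⟨x, hx, rfl⟩
    rw [EReal.neg_le]
    change (-x : EReal) ≤ _
    refine le_of_forall_lt fun c hc => ?_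
    obtain ⟨y, hy, hy'⟩ := EReal.lt_iff_exists_real_btwn.1 hc
    exact hy.trans_le (le_sSup ⟨y, hBA x hx y (by exact_mod_cast hy'), rfl⟩)
  · rw [EReal.le_neg]
    refine sSup_le ?_
    rintro _ ⟨x, hx, rfl⟩
    rw [EReal.le_neg]
    change _ ≤ (-x : EReal)
    refine le_of_forall_gt fun c hc => ?_
    obtain ⟨y, hy, hy'⟩ := EReal.lt_iff_exists_real_btwn.1 hc
    exact lt_of_le_of_lt (sInf_le ⟨y, hAB x hx y (by exact_mod_cast hy), rfl⟩) hy'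

variable {a b : ℕ → ℕ}

theorem liminf_spectralTrace_eq_one_iff {ρ : ∀ n, BipOp (a n) (b n)} (hρ : ∀ n, (ρ n).PosSemidef)
    (hρ1 : ∀ n, (ρ n).trace = 1) (γ : ℝ) :
    liminf (fun n => spectralTrace n γ (ρ n)
      ((1 : Matrix (Fin (a n)) (Fin (a n)) ℂ) ⊗ₖ trA (ρ n))) atTop = 1 ↔
    Tendsto (fun n : ℕ => posTr (diffA (Real.exp (n * γ)) (ρ n))) atTop (𝓝 1) :=
  liminf_eq_one_iff_tendsto (fun n => posTr_nonneg (isHermitian_diffA _ (hρ n).isHermitian))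
    fun n => (posTr_diffA_le_trace (Real.exp_pos _).le (hρ n)).trans_eq (by simp [hρ1])

variable {φ : ∀ n, BipVec (a n) (b n)}

theorem limsup_spectralTrace_eq_zero_iff (hφ : ∀ n, ‖φ n‖ = 1) (γ : ℝ) :
    limsup (fun n => spectralTrace n γ (trA (ketBra (φ n))) 1) atTop = 0 ↔
    Tendsto (fun n : ℕ => posTr (trA (ketBra (φ n)) - Real.exp (n * γ) • 1)) atTop (𝓝 0) := by
  have hρ : ∀ n, (trA (ketBra (φ n))).PosSemidef := fun n => posSemidef_trA (posSemidef_ketBra _)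
  refine limsup_eq_zero_iff_tendsto (fun n => posTr_nonneg
    ((hρ n).isHermitian.sub (isHermitian_real_smul Matrix.isHermitian_one _))) fun n => ?_
  refine (posTr_le_re_trace (Matrix.nonneg_iff_posSemidef.2 (hρ n)) (sub_le_self _ ?_)).trans_eq ?_
  · simpa using real_smul_mono (zero_le_one_matrix (ι := Fin (b n))) (Real.exp_pos (n * γ)).le
  · rw [trace_trA, trace_ketBra (hφ n), Complex.one_re]

theorem tendsto_posTr_diffA_one (hφ : ∀ n, ‖φ n‖ = 1) {x y : ℝ} (hxy : y < -x)
    (h : Tendsto (fun n : ℕ => posTr (trA (ketBra (φ n)) - Real.exp (n * x) • 1)) atTop (𝓝 0)) :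
    Tendsto (fun n : ℕ => posTr (diffA (Real.exp (n * y)) (ketBra (φ n)))) atTop (𝓝 1) := by
  -- A threshold with `x < z < -y`: the first inequality gives `q → 1`, the second kills the error
  -- `exp (n (y + z))`.
  obtain ⟨z, hz, hz'⟩ := exists_between (lt_neg.1 hxy)
  set q : ℕ → ℝ := fun n =>
    (lowProj (Real.exp (n * z)) (trA (ketBra (φ n))) * trA (ketBra (φ n))).trace.re
  have hρ : ∀ n, (trA (ketBra (φ n))).PosSemidef := fun n => posSemidef_trA (posSemidef_ketBra _)
  have hρ1 : ∀ n, (trA (ketBra (φ n))).trace.re = 1 := fun n => by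
    rw [trace_trA, trace_ketBra (hφ n), Complex.one_re]
  have hxz := tendsto_exp_nat_mul_zero (sub_neg.2 hz)
  have hq0 : ∀ n, q n ≤ 1 := fun n => by
    have := re_trace_mul_mono_left (Matrix.nonneg_iff_posSemidef.2 (hρ n))
      (lowProj_le_one (Real.exp (n * z)) (trA (ketBra (φ n))))
    rwa [one_mul, hρ1] at this
  have hq1 : ∀ᶠ n : ℕ in atTop, 1 - posTr (trA (ketBra (φ n)) - Real.exp (n * x) • 1) /
      (1 - Real.exp (n * (x - z))) ≤ q n := by
    filter_upwards [hxz.eventually_lt_const one_pos] with n hn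
    have h1 := le_posTr_sub_smul_one (Real.exp_pos (n * x)).le (Real.exp_pos (n * z)) (hρ n)
    rw [← Real.exp_sub, ← mul_sub, hρ1] at h1
    rw [sub_le_comm, le_div_iff₀ (sub_pos.2 hn), mul_comm]
    exact h1
  have hq : Tendsto q atTop (𝓝 1) := by
    refine tendsto_of_tendsto_of_tendsto_of_le_of_le' ?_ tendsto_const_nhds hq1
      (Eventually.of_forall hq0)
    have := (h.div (hxz.const_sub 1) (by norm_num)).const_sub 1
    simpa using this
  have hlow : Tendsto (fun n : ℕ => q n ^ 2 - Real.exp (n * (y + z))) atTop (𝓝 1) := by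
    have := (hq.pow 2).sub (tendsto_exp_nat_mul_zero (show y + z < 0 by linarith))
    simpa using this
  refine tendsto_of_tendsto_of_tendsto_of_le_of_le hlow tendsto_const_nhds (fun n => ?_)
    fun n => ?_
  · have := le_posTr_diffA (Real.exp_pos (n * y)).le (Real.exp_pos (n * z)).le (hφ n)
    rwa [← Real.exp_add, ← mul_add] at this
  · exact (posTr_diffA_le_trace (Real.exp_pos _).le (posSemidef_ketBra _)).trans_eq
      (by rw [trace_ketBra (hφ n), Complex.one_re])

theorem tendsto_posTr_sub_smul_one_zero (hφ : ∀ n, ‖φ n‖ = 1) {x y : ℝ} (hxy : -x < y)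
    (h : Tendsto (fun n : ℕ => posTr (diffA (Real.exp (n * x)) (ketBra (φ n)))) atTop (𝓝 1)) :
    Tendsto (fun n : ℕ => posTr (trA (ketBra (φ n)) - Real.exp (n * y) • 1)) atTop (𝓝 0) := by
  have hρ : ∀ n, (trA (ketBra (φ n))).PosSemidef := fun n => posSemidef_trA (posSemidef_ketBra _)
  have hρ1 : ∀ n, (trA (ketBra (φ n))).trace.re = 1 := fun n => by
    rw [trace_trA, trace_ketBra (hφ n), Complex.one_re]
  -- This is the splitting parameter `s`, chosen so that `1 + s = c * t`; as it diverges, the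
  -- prefactor `1 + 1 / s` tends to 1.
  have hs : Tendsto (fun n : ℕ => Real.exp (n * (x + y)) - 1) atTop atTop :=
    tendsto_atTop_add_const_right _ _ (tendsto_exp_nat_mul_atTop (by linarith))
  have hup : Tendsto (fun n : ℕ => 1 - posTr (diffA (Real.exp (n * x)) (ketBra (φ n))) /
      (1 + 1 / (Real.exp (n * (x + y)) - 1))) atTop (𝓝 0) := by
    have h1 := (tendsto_const_nhds (x := (1 : ℝ))).div_atTop hs
    have := (h.div (h1.const_add 1) (by norm_num)).const_sub 1
    simpa using this
  refine tendsto_of_tendsto_of_tendsto_of_le_of_le' tendsto_const_nhds hup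
    (Eventually.of_forall fun n => posTr_nonneg
      ((hρ n).isHermitian.sub (isHermitian_real_smul Matrix.isHermitian_one _))) ?_
  filter_upwards [hs.eventually_gt_atTop 0] with n hn
  have h1 := posTr_sub_smul_one_le (Real.exp_pos (n * y)).le (hρ n)
  have h2 := posTr_diffA_le_lowProj (t := Real.exp (n * y)) (Real.exp_pos (n * x)).le hn
    (by rw [← Real.exp_add, ← mul_add]; linarith) (hφ n)
  rw [hρ1] at h1
  refine h1.trans (sub_le_sub_left ?_ _)
  rw [div_le_iff₀' (by positivity)]
  exact h2

theorem supCondEntropy_ketBra (hφ : ∀ n, ‖φ n‖ = 1) :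
    supCondEntropy (fun n => ketBra (φ n)) = -infEntropy (fun n => trA (ketBra (φ n))) := by
  rw [supCondEntropy, infEntropy, neg_neg]
  have hA := liminf_spectralTrace_eq_one_iff (fun n => posSemidef_ketBra (φ n))
    (fun n => trace_ketBra (hφ n))
  have hB := limsup_spectralTrace_eq_zero_iff hφ
  exact neg_sSup_eq_sInf
    (fun x hx y hxy => (hA y).2 (tendsto_posTr_diffA_one hφ hxy ((hB x).1 hx)))
    (fun x hx y hxy => (hB y).2 (tendsto_posTr_sub_smul_one_zero hφ hxy ((hA x).1 hx)))

theorem supCondEntropy_le_of_isLOCC (hφ : ∀ n, ‖φ n‖ = 1) {a' b' : ℕ → ℕ}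
    {T : ∀ n, BipOp (a n) (b n) → BipOp (a' n) (b' n)} (hT : ∀ n, IsLOCC (T n)) :
    supCondEntropy (fun n => ketBra (φ n)) ≤ supCondEntropy (fun n => T n (ketBra (φ n))) := by
  refine EReal.neg_le_neg_iff.2 (sSup_le_sSup (Set.image_mono fun γ hγ => ?_))
  refine (liminf_spectralTrace_eq_one_iff (fun n => posSemidef_ketBra (φ n))
    (fun n => trace_ketBra (hφ n)) γ).2 ?_
  have h := (liminf_spectralTrace_eq_one_iff (fun n => (hT n).posSemidef (posSemidef_ketBra (φ n)))
    (fun n => by rw [(hT n).trace, trace_ketBra (hφ n)]) γ).1 hγ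
  refine tendsto_of_tendsto_of_tendsto_of_le_of_le h tendsto_const_nhds
    (fun n => (hT n).posTr_diffA_le (Real.exp_pos _).le (φ n)) fun n => ?_
  exact (posTr_diffA_le_trace (Real.exp_pos _).le (posSemidef_ketBra _)).trans_eq
    (by rw [trace_ketBra (hφ n), Complex.one_re])

theorem Concentration.fid_sub_le {a b : ℕ} (P : Concentration a b) {ψ : BipVec a b}
    (hψ : ‖ψ‖ = 1) {c : ℝ} (hc : 0 ≤ c) :
    P.fid (ketBra ψ) - c / P.M ≤ posTr (diffA c (ketBra ψ)) :=
  (fidelity_sub_le_posTr P.M_pos P.e_orthonormal P.f_orthonormal hc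
    (P.isLOCC.posSemidef (posSemidef_ketBra ψ)) (by rw [P.isLOCC.trace, trace_ketBra hψ])).trans
    (P.isLOCC.posTr_diffA_le hc ψ)

/-- Weak converse: an asymptotically faithful concentration rate is at most the inf-spectral
entropy rate of the reduced states. -/
theorem le_infEntropy_of_concentration (hφ : ∀ n, ‖φ n‖ = 1) {R : ℝ}
    (h : ∀ ε : ℝ, 0 < ε → ∀ᶠ n : ℕ in atTop, ∃ P : Concentration (a n) (b n),
      1 - ε ≤ P.fid (ketBra (φ n)) ∧ R ≤ 1 / (n : ℝ) * Real.log P.M) :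
    (R : EReal) ≤ infEntropy (fun n => trA (ketBra (φ n))) := by
  have hS : infEntropy (fun n => trA (ketBra (φ n))) =
      infDiv (fun n => ketBra (φ n))
        (fun n => (1 : Matrix (Fin (a n)) (Fin (a n)) ℂ) ⊗ₖ trA (ketBra (φ n))) := by
    rw [← neg_neg (infEntropy _), ← supCondEntropy_ketBra hφ, supCondEntropy, neg_neg]
  rw [hS]
  refine le_of_forall_lt fun c hc => ?_
  obtain ⟨γ, hcγ, hγ⟩ := EReal.lt_iff_exists_real_btwn.1 hc
  have hγR : γ < R := by exact_mod_cast hγ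
  refine hcγ.trans_le (le_sSup ⟨γ, ?_, rfl⟩)
  refine (liminf_spectralTrace_eq_one_iff (fun n => posSemidef_ketBra (φ n))
    (fun n => trace_ketBra (hφ n)) γ).2 ?_
  refine tendsto_order.2 ⟨fun x hx => ?_, fun x hx => Eventually.of_forall fun n => ?_⟩
  -- Half of the gap `1 - x` is allotted to the infidelity, half to `exp (n γ) / M ≤ exp (n (γ -
  -- R))`.
  · have hε : 0 < (1 - x) / 2 := by linarith
    filter_upwards [h _ hε, (tendsto_exp_nat_mul_zero (sub_neg.2 hγR)).eventually_lt_const hε,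
      eventually_gt_atTop 0] with n ⟨P, hP, hR⟩ hn hn0
    have hn' : (0 : ℝ) < n := Nat.cast_pos.2 hn0
    have hM : (0 : ℝ) < P.M := Nat.cast_pos.2 P.M_pos
    have h1 := P.fid_sub_le (hφ n) (Real.exp_pos (n * γ)).le
    have h2 : Real.exp (n * γ) / P.M ≤ Real.exp (n * (γ - R)) := by
      rw [mul_sub, Real.exp_sub]
      refine div_le_div_of_nonneg_left (Real.exp_pos _).le (Real.exp_pos _) ?_
      rw [← Real.le_log_iff_exp_le hM]
      rwa [one_div, ← div_eq_inv_mul, le_div_iff₀ hn', mul_comm] at hR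
    linarith
  · refine lt_of_le_of_lt ((posTr_diffA_le_trace (Real.exp_pos _).le
      (posSemidef_ketBra _)).trans_eq ?_) hx
    rw [trace_ketBra (hφ n), Complex.one_re]

/-- No boundedness is needed: if no eventual lower bound existed, the real `liminf` would take the
default value `sSup ∅ = 0`, not 1. -/
theorem eventually_le_of_liminf_eq_one {u : ℕ → ℝ} (h : liminf u atTop = 1) {ε : ℝ}
    (hε : 0 < ε) : ∀ᶠ n in atTop, 1 - ε ≤ u n := by
  rw [liminf_eq] at h
  have hne : {x | ∀ᶠ n in atTop, x ≤ u n}.Nonempty := by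
    by_contra hne
    rw [Set.not_nonempty_iff_eq_empty.1 hne, Real.sSup_empty] at h
    exact zero_ne_one h
  obtain ⟨x, hx, hx'⟩ := exists_lt_of_lt_csSup hne ((sub_lt_self 1 hε).trans_eq h.symm)
  exact Eventually.mono hx fun n hn => hx'.le.trans hn

end Asymptotics

end

end EntConc

theorem mainTheorem2 (a b : ℕ → ℕ) (φ : ∀ n, EntConc.BipVec (a n) (b n))
    (hφ : ∀ n, ‖φ n‖ = 1) :
    (∀ (a' b' : ℕ → ℕ) (T : ∀ n, EntConc.BipOp (a n) (b n) → EntConc.BipOp (a' n) (b' n)),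
      (∀ n, EntConc.IsLOCC (T n)) →
        EntConc.supCondEntropy (fun n => EntConc.ketBra (φ n)) ≤
          EntConc.supCondEntropy (fun n => T n (EntConc.ketBra (φ n)))) ∧
    EntConc.supCondEntropy (fun n => EntConc.ketBra (φ n)) =
      -EntConc.infEntropy (fun n => EntConc.trA (EntConc.ketBra (φ n))) ∧
    (∀ R : ℝ, EntConc.infEntropy (fun n => EntConc.trA (EntConc.ketBra (φ n))) < (R : EReal) →
      ¬ EntConc.IsAchievableDistillationRate (fun n => EntConc.ketBra (φ n)) R ∧
      ∀ P : ∀ n, EntConc.Concentration (a n) (b n),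
        (∀ᶠ n : ℕ in Filter.atTop, R ≤ 1 / (n : ℝ) * Real.log (P n).M) →
          ¬ EntConc.IsReliable P (fun n => EntConc.ketBra (φ n))) := by
  refine ⟨fun a' b' T hT => EntConc.supCondEntropy_le_of_isLOCC hφ hT,
    EntConc.supCondEntropy_ketBra hφ, fun R hR => ⟨fun h => ?_, fun P hP h => ?_⟩⟩
  · refine hR.not_ge (EntConc.le_infEntropy_of_concentration hφ fun ε hε => ?_)
    obtain ⟨N, hN⟩ := h ε hε
    exact Filter.eventually_atTop.2 ⟨N, hN⟩
  · refine hR.not_ge (EntConc.le_infEntropy_of_concentration hφ fun ε hε => ?_)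
    filter_upwards [hP, EntConc.eventually_le_of_liminf_eq_one h hε] with n h1 h2
    exact ⟨P n, h2, h1⟩
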